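/- Let $H$ be a separable infinite-dimensional complex Hilbert space. "Ideal" means two-sided ideal of the algebra $B(H)$ of bounded operators on $H$, and $I+J=\{A+B : A\in I,\ B\in J\}$. For $X\in B(H)$ let $s(X)=\langle s_n(X)\rangle_{n\ge 1}$ be its sequence of $s$-numbers, $s_n(X)=\inf\{\|X-F\| : \operatorname{rank}F\le n-1\}$ (for compact $X$, the eigenvalues of $|X|$ in decreasing order, repeated according to multiplicity), and for an ideal $I$ let $\Sigma(I)=\{s(X) : X\in I\}$. Let $c_o^*$ be the set of nonnegative sequences decreasing (not necessarily strictly) to $0$; for a set $S\subset c_o^*$ let $\mathcal I(S)$ be the ideal generated by all $X\in B(H)$ with $s(X)\in S$. For a sequence $\xi$ let $\xi_a=\langle \frac1n\sum_{i=1}^n\xi_i\rangle_{n\ge1}$ be its arithmetic mean. The pre-arithmetic mean ideal ${}_aI$, the arithmetic mean ideal $I_a$ and the am-closure $I^-$ of an ideal $I$ are $$ {}_aI=\mathcal I\big(\{\xi\in c_o^* : \xi_a\in\Sigma(I)\}\big),$$ $$ I_a=\mathcal I\big(\{\xi\in c_o^* : \text{there are } \eta\in\Sigma(I) \text{ and }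 C\in\mathbb R \text{ with } \xi_n\le C(\eta_a)_n \text{ for all } n\}\big),$$ $$ I^-={}_a(I_a),$$ and $I$ is called am-closed if $I^-=I$. (For $I\ne B(H)$ the two sets in braces are exactly the characteristic sets $\Sigma({}_aI)$ and $\Sigma(I_a)$.) **Theorem 2.5.** For all ideals $I$, $J$ of $B(H)$, $$(I+J)^-=I^-+J^-.$$ In particular, the sum of two am-closed ideals is am-closed. -/

import Mathlib

open Filter Topology

noncomputable section

namespace OperatorIdeal

/-- The arithmetic (Cesaro) mean `ξ_a` of a sequence. Sequences are indexed from `0`, so the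
`n`-th entry is the average of the first `n + 1` entries of `ξ`. -/
def arithMean (ξ : ℕ → ℝ) : ℕ → ℝ :=
  fun n => (∑ i ∈ Finset.range (n + 1), ξ i) / ((n : ℝ) + 1)

/-- `c_o^*`: the nonnegative sequences decreasing (in the weak sense) to `0`. -/
def c0Star : Set (ℕ → ℝ) :=
  {ξ | Antitone ξ ∧ (∀ n, 0 ≤ ξ n) ∧ Tendsto ξ atTop (𝓝 0)}

variable {H : Type*} [NormedAddCommGroup H] [InnerProductSpace ℂ H] [CompleteSpace H]

/-- The sequence `s(X)` of the `s`-numbers of a bounded operator `X`: the entry with index `n`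
(counted from `0`) is the distance from `X` to the operators of rank at most `n`. For compact `X`
this is the `(n + 1)`-st eigenvalue of `|X|` in decreasing order, counted with multiplicity. -/
def sNumbers (X : H →L[ℂ] H) : ℕ → ℝ :=
  fun n => sInf {r : ℝ | ∃ F : H →L[ℂ] H,
    LinearMap.rank (F : H →ₗ[ℂ] H) ≤ (n : Cardinal) ∧ r = ‖X - F‖}

/-- The characteristic set `Σ(I)` of a two-sided ideal `I` of `B(H)`. -/
def charSet (I : TwoSidedIdeal (H →L[ℂ] H)) : Set (ℕ → ℝ) :=
  {ξ | ∃ X ∈ I, sNumbers X = ξ}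

variable (H) in
/-- The inverse of the Calkin correspondence: the two-sided ideal of `B(H)` belonging to a set `S`
of sequences, namely the ideal generated by the operators whose `s`-number sequence is in `S`.
(All operators with the same `s`-number sequence `ξ` in `c_o^*` generate the same ideal as the
diagonal operator `diag ξ`.) -/
def idealOf (S : Set (ℕ → ℝ)) : TwoSidedIdeal (H →L[ℂ] H) :=
  TwoSidedIdeal.span {X | sNumbers X ∈ S}

/-- The pre-arithmetic mean ideal `_aI`, with characteristic set
`{ξ ∈ c_o^* | ξ_a ∈ Σ(I)}`. -/
def preMeanIdeal (I : TwoSidedIdeal (H →L[ℂ] H)) : TwoSidedIdeal (H →L[ℂ] H) :=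
  idealOf H {ξ | ξ ∈ c0Star ∧ arithMean ξ ∈ charSet I}

/-- The arithmetic mean ideal `I_a`, with characteristic set
`{ξ ∈ c_o^* | ξ = O(η_a) for some η ∈ Σ(I)}`. The bound is required at every index, so that only
`ξ = 0` is `O(0)`. -/
def meanIdeal (I : TwoSidedIdeal (H →L[ℂ] H)) : TwoSidedIdeal (H →L[ℂ] H) :=
  idealOf H {ξ | ξ ∈ c0Star ∧ ∃ η ∈ charSet I, ∃ C : ℝ, ∀ n, ξ n ≤ C * arithMean η n}

/-- The am-closure `I^- = _a(I_a)`. -/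
def amClosure (I : TwoSidedIdeal (H →L[ℂ] H)) : TwoSidedIdeal (H →L[ℂ] H) :=
  preMeanIdeal (meanIdeal I)

/-- An ideal is am-closed if it coincides with its am-closure. -/
def IsAmClosed (I : TwoSidedIdeal (H →L[ℂ] H)) : Prop :=
  amClosure I = I

end OperatorIdeal

end

/-! The am-closure is monotone, so the content is `amClosure_sup_le`, and it suffices to treat a
generator `X` of the closure of the sum. Its arithmetic mean is the `s`-number sequence of an
operator in the mean ideal, hence is dominated by a multiple of the mean of `s(B + D)` with `B ∈ I`,
`D ∈ J` (`exists_le_mul_arithMean_of_mem_meanIdeal`). In terms of partial sums, `s(X)` is weakly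
majorized by `2C s(B) + 2C s(D)`.

The heart is `exists_add_eq_of_sum_le`: such a sequence splits as `ζ + τ`, both decreasing, with `ζ`
weakly majorized by the first summand and `τ` by the second. The partial sums of `ζ` form the least
concave majorant of `max (Ξ - M) 0`, where `Ξ`, `M` are the partial sums of `s(X)` and of the second
summand.

The Schmidt decomposition `exists_schmidt` lifts the splitting to `X = Y + W` with `s(Y) = ζ`, `s(W)
= τ` (`exists_add_eq_of_sNumbers`), and `mem_amClosure_of_sum_le` puts `Y` and `W` in the two
closures. Only generators are handled, so the full Calkin correspondence is not needed. -/

namespace OperatorIdeal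

/-! ### Concave majorants and weak majorization -/

/-- An antitone sequence whose partial sums are bounded below is nonnegative. -/
lemma nonneg_of_antitone_of_le_sum {d : ℕ → ℝ} (hd : Antitone d) {B : ℝ}
    (hB : ∀ n, B ≤ ∑ i ∈ Finset.range n, d i) (k : ℕ) : 0 ≤ d k := by
  by_contra! hk
  -- Past `k` every term is at most `d k < 0`, so the partial sums fall at least linearly.
  have key : ∀ m : ℕ, ∑ i ∈ Finset.range (k + m), d i
      ≤ ∑ i ∈ Finset.range k, d i + m * d k := by
    intro m
    rw [Finset.sum_range_add]
    have : ∑ x ∈ Finset.range m, d (k + x) ≤ ∑ _x ∈ Finset.range m, d k :=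
      Finset.sum_le_sum fun i _ => hd (Nat.le_add_right k i)
    simp only [Finset.sum_const, Finset.card_range, nsmul_eq_mul] at this
    linarith
  obtain ⟨m, hm⟩ := exists_nat_gt ((∑ i ∈ Finset.range k, d i - B) / (-d k))
  rw [div_lt_iff₀ (by linarith)] at hm
  have := hB (k + m)
  have := key m
  linarith

/-- The pointwise infimum of the concave majorants of `h` is a concave majorant, and its second
difference vanishes wherever it does not touch `h`. -/
lemma exists_least_concave_majorant (h : ℕ → ℝ) (S : Set (ℕ → ℝ))
    (hS : S = {g | (∀ n, g n + g (n + 2) ≤ 2 * g (n + 1)) ∧ ∀ n, h n ≤ g n})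
    (hne : S.Nonempty) :
    ∃ Z ∈ S, (∀ g ∈ S, ∀ n, Z n ≤ g n) ∧
      ∀ n, 2 * Z (n + 1) ≤ Z n + Z (n + 2) ∨ Z (n + 1) = h (n + 1) := by
  have hbdd : ∀ n, BddBelow ((fun g : ℕ → ℝ => g n) '' S) := by
    intro n
    refine ⟨h n, ?_⟩
    rintro _ ⟨g, hg, rfl⟩
    rw [hS] at hg
    exact hg.2 n
  set Z : ℕ → ℝ := fun n => sInf ((fun g : ℕ → ℝ => g n) '' S) with hZ
  have hle : ∀ g ∈ S, ∀ n, Z n ≤ g n := fun g hg n => csInf_le (hbdd n) ⟨g, hg, rfl⟩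
  have hge : ∀ n c, (∀ g ∈ S, c ≤ g n) → c ≤ Z n := by
    intro n c hc
    refine le_csInf (hne.image _) ?_
    rintro _ ⟨g, hg, rfl⟩
    exact hc g hg
  have hZh : ∀ n, h n ≤ Z n := by
    intro n
    refine hge n _ fun g hg => ?_
    rw [hS] at hg
    exact hg.2 n
  have hZc : ∀ n, Z n + Z (n + 2) ≤ 2 * Z (n + 1) := by
    intro n
    have : (Z n + Z (n + 2)) / 2 ≤ Z (n + 1) := by
      refine hge _ _ fun g hg => ?_
      have h1 := hle g hg n
      have h2 := hle g hg (n + 2)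
      rw [hS] at hg
      have h3 := hg.1 n
      linarith
    linarith
  have hZS : Z ∈ S := by rw [hS]; exact ⟨hZc, hZh⟩
  refine ⟨Z, hZS, hle, fun n => ?_⟩
  by_contra! hcon
  obtain ⟨hc1, hc2⟩ := hcon
  have hlt : h (n + 1) < Z (n + 1) := lt_of_le_of_ne (hZh _) (Ne.symm hc2)
  -- If both alternatives fail, `Z` can be lowered at the single index `n + 1` to the least value
  -- allowed by `h` and by concavity there. Concavity at other midpoints survives, since outer
  -- values only decrease. This contradicts minimality.
  set c := max (h (n + 1)) ((Z n + Z (n + 2)) / 2) with hc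
  have hcZ : c < Z (n + 1) := max_lt hlt (by linarith)
  have hc3 : (Z n + Z (n + 2)) / 2 ≤ c := le_max_right _ _
  have hmem : Function.update Z (n + 1) c ∈ S := by
    rw [hS]
    have hup : ∀ m, Function.update Z (n + 1) c m ≤ Z m := by
      intro m
      rcases eq_or_ne m (n + 1) with rfl | hm
      · simpa using hcZ.le
      · simp [Function.update_of_ne hm]
    constructor
    · intro m
      rcases eq_or_ne m n with rfl | hm
      · rw [Function.update_self, Function.update_of_ne (by omega),
          Function.update_of_ne (by omega)]
        linarith
      · have h1 := hup m
        have h2 := hup (m + 2)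
        rw [Function.update_of_ne (show m + 1 ≠ n + 1 by omega)]
        have := hZc m
        linarith
    · intro m
      rcases eq_or_ne m (n + 1) with rfl | hm
      · rw [Function.update_self]
        exact le_max_left _ _
      · simpa [Function.update_of_ne hm] using hZh m
  have := hle _ hmem (n + 1)
  rw [Function.update_self] at this
  linarith

/-- **Decomposition for weak majorization**: if a decreasing nonnegative sequence is weakly
majorized by the sum of two such sequences, then it is a sum of two such sequences that are
weakly majorized by the respective summands. -/
theorem exists_add_eq_of_sum_le {ξ ρ μ : ℕ → ℝ} (hξ : Antitone ξ) (hρ : Antitone ρ)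
    (hμ : Antitone μ) (hξ0 : ∀ n, 0 ≤ ξ n) (hρ0 : ∀ n, 0 ≤ ρ n) (hμ0 : ∀ n, 0 ≤ μ n)
    (hle : ∀ n, ∑ i ∈ Finset.range n, ξ i
      ≤ ∑ i ∈ Finset.range n, ρ i + ∑ i ∈ Finset.range n, μ i) :
    ∃ ζ τ : ℕ → ℝ, Antitone ζ ∧ Antitone τ ∧ (∀ n, 0 ≤ ζ n) ∧ (∀ n, 0 ≤ τ n) ∧
      (∀ n, ζ n + τ n = ξ n) ∧
      (∀ n, ∑ i ∈ Finset.range n, ζ i ≤ ∑ i ∈ Finset.range n, ρ i) ∧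
      ∀ n, ∑ i ∈ Finset.range n, τ i ≤ ∑ i ∈ Finset.range n, μ i := by
  set Ξ : ℕ → ℝ := fun n => ∑ i ∈ Finset.range n, ξ i with hΞ
  set R : ℕ → ℝ := fun n => ∑ i ∈ Finset.range n, ρ i with hR
  set M : ℕ → ℝ := fun n => ∑ i ∈ Finset.range n, μ i with hM
  have Ξs : ∀ n, Ξ (n + 1) = Ξ n + ξ n := fun n => Finset.sum_range_succ _ _
  have Rs : ∀ n, R (n + 1) = R n + ρ n := fun n => Finset.sum_range_succ _ _
  have Ms : ∀ n, M (n + 1) = M n + μ n := fun n => Finset.sum_range_succ _ _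
  have Ξ0 : ∀ n, 0 ≤ Ξ n := fun n => Finset.sum_nonneg fun i _ => hξ0 i
  have R0 : ∀ n, 0 ≤ R n := fun n => Finset.sum_nonneg fun i _ => hρ0 i
  have M0 : ∀ n, 0 ≤ M n := fun n => Finset.sum_nonneg fun i _ => hμ0 i
  have hΞz : Ξ 0 = 0 := by simp [hΞ]
  have hMz : M 0 = 0 := by simp [hM]
  -- A concave `Z ≥ Ξ - M` makes the sums of `τ`, namely `Ξ - Z`, at most `M`. The truncation at `0`
  -- keeps `Z`, and hence `ζ`, nonnegative.
  set h : ℕ → ℝ := fun n => max (Ξ n - M n) 0 with hh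
  set S : Set (ℕ → ℝ) := {g | (∀ n, g n + g (n + 2) ≤ 2 * g (n + 1)) ∧ ∀ n, h n ≤ g n} with hS
  -- Minimality against `Ξ` gives `Z ≤ Ξ`, so the sums of `τ` are nonnegative; against `R` it gives
  -- the majorization of `ζ`.
  have hΞS : Ξ ∈ S := by
    refine ⟨fun n => ?_, fun n => max_le (by linarith [M0 n]) (Ξ0 n)⟩
    have := hξ (Nat.le_succ n)
    rw [Ξs (n + 1), Ξs n]
    simp only [Nat.succ_eq_add_one] at this
    linarith
  have hRS : R ∈ S := by
    refine ⟨fun n => ?_, fun n => max_le (by linarith [hle n]) (R0 n)⟩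
    have := hρ (Nat.le_succ n)
    rw [Rs (n + 1), Rs n]
    simp only [Nat.succ_eq_add_one] at this
    linarith
  obtain ⟨Z, hZS, hmin, htouch⟩ := exists_least_concave_majorant h S hS ⟨Ξ, hΞS⟩
  have hZ0 : ∀ n, 0 ≤ Z n := fun n => (le_max_right _ _).trans (hZS.2 n)
  have hZh : ∀ n, Ξ n - M n ≤ Z n := fun n => (le_max_left _ _).trans (hZS.2 n)
  have hZz : Z 0 = 0 := le_antisymm ((hmin Ξ hΞS 0).trans hΞz.le) (hZ0 0)
  have hsum : ∀ n, ∑ i ∈ Finset.range n, (Z (i + 1) - Z i) = Z n := by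
    intro n
    rw [Finset.sum_range_sub, hZz, sub_zero]
  have hsum' : ∀ n, ∑ i ∈ Finset.range n, (ξ i - (Z (i + 1) - Z i)) = Ξ n - Z n := by
    intro n
    rw [Finset.sum_sub_distrib, hsum]
  have hζa : Antitone fun n => Z (n + 1) - Z n := by
    refine antitone_nat_of_succ_le fun n => ?_
    have := hZS.1 n
    show Z (n + 2) - Z (n + 1) ≤ _
    linarith
  have hτa : Antitone fun n => ξ n - (Z (n + 1) - Z n) := by
    refine antitone_nat_of_succ_le fun n => ?_
    show ξ (n + 1) - (Z (n + 2) - Z (n + 1)) ≤ _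
    have hξn := hξ (Nat.le_succ n)
    have hμn := hμ (Nat.le_succ n)
    simp only [Nat.succ_eq_add_one] at hξn hμn
    -- Off the contact set `Z` is affine around `n + 1`, so `τ` decreases because `ξ` does. Where `Z
    -- = Ξ - M`, the sequence `Ξ - Z ≤ M` touches the concave `M`, so its second difference is at
    -- most that of `M`. Where `Z = 0`, it has a minimum, so `ζ n ≤ 0 ≤ ζ (n + 1)`.
    rcases htouch n with h1 | h1
    · linarith
    · rcases max_choice (Ξ (n + 1) - M (n + 1)) 0 with h2 | h2
      · have e : Z (n + 1) = Ξ (n + 1) - M (n + 1) := h1.trans h2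
        have a := hZh n
        have b := hZh (n + 2)
        rw [Ξs (n + 1), Ms (n + 1)] at b
        have c := Ξs n
        have d := Ms n
        linarith
      · have e : Z (n + 1) = 0 := h1.trans h2
        linarith [hZ0 n, hZ0 (n + 2)]
  refine ⟨_, _, hζa, hτa, ?_, ?_, fun n => by ring, ?_, ?_⟩
  · exact nonneg_of_antitone_of_le_sum hζa (B := 0) fun n => by rw [hsum]; exact hZ0 n
  · refine nonneg_of_antitone_of_le_sum hτa (B := 0) fun n => ?_
    rw [hsum']
    linarith [hmin Ξ hΞS n]
  · intro n
    rw [hsum]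
    exact hmin R hRS n
  · intro n
    rw [hsum']
    linarith [hZh n]

/-! ### Arithmetic means -/

lemma arithMean_le_mul_iff {ξ η : ℕ → ℝ} {C : ℝ} {n : ℕ} :
    arithMean ξ n ≤ C * arithMean η n ↔
      ∑ i ∈ Finset.range (n + 1), ξ i ≤ C * ∑ i ∈ Finset.range (n + 1), η i := by
  unfold arithMean
  rw [← mul_div_assoc, div_le_div_iff_of_pos_right (by positivity)]

lemma arithMean_nonneg {ξ : ℕ → ℝ} (h : ∀ n, 0 ≤ ξ n) (n : ℕ) : 0 ≤ arithMean ξ n :=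
  div_nonneg (Finset.sum_nonneg fun i _ => h i) (by positivity)

lemma arithMean_antitone {ξ : ℕ → ℝ} (h : Antitone ξ) : Antitone (arithMean ξ) := by
  refine antitone_nat_of_succ_le fun n => ?_
  unfold arithMean
  rw [div_le_div_iff₀ (by positivity) (by positivity), Finset.sum_range_succ _ (n + 1)]
  have : ∑ _i ∈ Finset.range (n + 1), ξ (n + 1) ≤ ∑ i ∈ Finset.range (n + 1), ξ i :=
    Finset.sum_le_sum fun i hi => h (Finset.mem_range.1 hi).le
  simp only [Finset.sum_const, Finset.card_range, nsmul_eq_mul] at this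
  push_cast at this ⊢
  nlinarith

lemma arithMean_mem_c0Star {ξ : ℕ → ℝ} (h : ξ ∈ c0Star) : arithMean ξ ∈ c0Star := by
  refine ⟨arithMean_antitone h.1, arithMean_nonneg h.2.1, ?_⟩
  have := (h.2.2.cesaro).comp (tendsto_add_atTop_nat 1)
  refine this.congr fun n => ?_
  simp only [Function.comp, arithMean]
  push_cast
  rw [div_eq_inv_mul]

lemma arithMean_mono {ξ η : ℕ → ℝ} (h : ∀ n, ξ n ≤ η n) (n : ℕ) :
    arithMean ξ n ≤ arithMean η n :=
  div_le_div_of_nonneg_right (Finset.sum_le_sum fun i _ => h i) (by positivity)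

/-- Shortening the sum only decreases it, and the denominator shrinks by at most a factor 2. Means
thus absorb the index halving in the `s`-numbers of a sum. -/
lemma arithMean_half_le {η : ℕ → ℝ} (h : ∀ n, 0 ≤ η n) (n : ℕ) :
    arithMean η (n / 2) ≤ 2 * arithMean η n := by
  unfold arithMean
  rw [← mul_div_assoc, div_le_div_iff₀ (by positivity) (by positivity)]
  have h1 : ∑ i ∈ Finset.range (n / 2 + 1), η i ≤ ∑ i ∈ Finset.range (n + 1), η i :=
    Finset.sum_le_sum_of_subset_of_nonneg
      (Finset.range_mono (by omega)) fun i _ _ => h i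
  have h2 : (n : ℝ) + 1 ≤ 2 * (((n / 2 : ℕ) : ℝ) + 1) := by
    have : n + 1 ≤ 2 * (n / 2 + 1) := by omega
    exact_mod_cast this
  have h3 : 0 ≤ ∑ i ∈ Finset.range (n + 1), η i := Finset.sum_nonneg fun i _ => h i
  nlinarith [mul_le_mul h1 h2 (by positivity) h3]

/-- Summing over `i / 2` counts every term at most twice. -/
lemma sum_range_half_le {f : ℕ → ℝ} (hf : ∀ n, 0 ≤ f n) (n : ℕ) :
    ∑ i ∈ Finset.range n, f (i / 2) ≤ 2 * ∑ i ∈ Finset.range n, f i := by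
  have key : ∀ m, ∑ i ∈ Finset.range (2 * m), f (i / 2) = 2 * ∑ i ∈ Finset.range m, f i := by
    intro m
    induction m with
    | zero => simp
    | succ m ih =>
      rw [show 2 * (m + 1) = 2 * m + 1 + 1 by ring, Finset.sum_range_succ, Finset.sum_range_succ,
        ih, Finset.sum_range_succ, show (2 * m + 1) / 2 = m by omega,
        show 2 * m / 2 = m by omega]
      ring
  rw [← key]
  exact Finset.sum_le_sum_of_subset_of_nonneg (Finset.range_mono (by omega)) fun i _ _ => hf _

/-! ### Elementary inequalities for `s`-numbers -/

section SNumbers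

variable {H : Type*} [NormedAddCommGroup H] [InnerProductSpace ℂ H]

lemma sNumbers_bddBelow (X : H →L[ℂ] H) (n : ℕ) :
    BddBelow {r : ℝ | ∃ F : H →L[ℂ] H,
      LinearMap.rank (F : H →ₗ[ℂ] H) ≤ (n : Cardinal) ∧ r = ‖X - F‖} := by
  refine ⟨0, ?_⟩
  rintro _ ⟨F, -, rfl⟩
  exact norm_nonneg _

lemma sNumbers_nonempty (X : H →L[ℂ] H) (n : ℕ) :
    {r : ℝ | ∃ F : H →L[ℂ] H,
      LinearMap.rank (F : H →ₗ[ℂ] H) ≤ (n : Cardinal) ∧ r = ‖X - F‖}.Nonempty := by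
  refine ⟨_, 0, ?_, rfl⟩
  rw [ContinuousLinearMap.toLinearMap_zero, LinearMap.rank_zero]
  exact zero_le

lemma sNumbers_le (X : H →L[ℂ] H) {n : ℕ} {F : H →L[ℂ] H}
    (hF : LinearMap.rank (F : H →ₗ[ℂ] H) ≤ (n : Cardinal)) : sNumbers X n ≤ ‖X - F‖ :=
  csInf_le (sNumbers_bddBelow X n) ⟨F, hF, rfl⟩

lemma le_sNumbers (X : H →L[ℂ] H) {n : ℕ} {c : ℝ}
    (h : ∀ F : H →L[ℂ] H, LinearMap.rank (F : H →ₗ[ℂ] H) ≤ (n : Cardinal) → c ≤ ‖X - F‖) :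
    c ≤ sNumbers X n := by
  refine le_csInf (sNumbers_nonempty X n) ?_
  rintro _ ⟨F, hF, rfl⟩
  exact h F hF

lemma exists_norm_sub_lt (X : H →L[ℂ] H) {n : ℕ} {c : ℝ} (h : sNumbers X n < c) :
    ∃ F : H →L[ℂ] H, LinearMap.rank (F : H →ₗ[ℂ] H) ≤ (n : Cardinal) ∧ ‖X - F‖ < c := by
  obtain ⟨_, ⟨F, hF, rfl⟩, hlt⟩ := exists_lt_of_csInf_lt (sNumbers_nonempty X n) h
  exact ⟨F, hF, hlt⟩

lemma sNumbers_nonneg (X : H →L[ℂ] H) (n : ℕ) : 0 ≤ sNumbers X n :=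
  le_sNumbers X fun _ _ => norm_nonneg _

lemma sNumbers_antitone (X : H →L[ℂ] H) : Antitone (sNumbers X) := fun _ _ hmn =>
  le_sNumbers X fun _ hF => sNumbers_le X (hF.trans (by exact_mod_cast hmn))

lemma sNumbers_zero (n : ℕ) : sNumbers (0 : H →L[ℂ] H) n = 0 := by
  refine le_antisymm ?_ (sNumbers_nonneg _ _)
  have := sNumbers_le (0 : H →L[ℂ] H) (n := n) (F := 0) (by
    rw [ContinuousLinearMap.toLinearMap_zero, LinearMap.rank_zero]
    exact zero_le)
  simpa using this

/-- Near-optimal approximants of rank at most `m` and `n` add up to one of rank at most `m + n`. -/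
lemma sNumbers_add_le (X Y : H →L[ℂ] H) (m n : ℕ) :
    sNumbers (X + Y) (m + n) ≤ sNumbers X m + sNumbers Y n := by
  refine le_of_forall_pos_le_add fun ε hε => ?_
  obtain ⟨F, hF, hF'⟩ := exists_norm_sub_lt X (lt_add_of_pos_right (sNumbers X m) (half_pos hε))
  obtain ⟨G, hG, hG'⟩ := exists_norm_sub_lt Y (lt_add_of_pos_right (sNumbers Y n) (half_pos hε))
  have h1 : sNumbers (X + Y) (m + n) ≤ ‖X + Y - (F + G)‖ := by
    refine sNumbers_le _ ?_
    rw [ContinuousLinearMap.toLinearMap_add]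
    refine (LinearMap.rank_add_le _ _).trans ?_
    push_cast
    exact add_le_add hF hG
  have h2 : ‖X + Y - (F + G)‖ ≤ ‖X - F‖ + ‖Y - G‖ := by
    rw [add_sub_add_comm]
    exact norm_add_le _ _
  linarith

lemma sNumbers_add_le_half (X Y : H →L[ℂ] H) (n : ℕ) :
    sNumbers (X + Y) n ≤ sNumbers X (n / 2) + sNumbers Y (n / 2) :=
  (sNumbers_antitone _ (by omega)).trans (sNumbers_add_le X Y (n / 2) (n / 2))

lemma sNumbers_mul_left_le (A X : H →L[ℂ] H) (n : ℕ) :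
    sNumbers (A * X) n ≤ ‖A‖ * sNumbers X n := by
  rcases (norm_nonneg A).eq_or_lt with hA | hA
  · rw [eq_comm, norm_eq_zero] at hA
    simp [hA, sNumbers_zero]
  · rw [← div_le_iff₀' hA]
    refine le_sNumbers X fun F hF => ?_
    rw [div_le_iff₀' hA]
    refine (sNumbers_le (A * X) (F := A * F) ?_).trans ?_
    · exact (LinearMap.rank_comp_le_right (F : H →ₗ[ℂ] H) (A : H →ₗ[ℂ] H)).trans hF
    · rw [← mul_sub]
      exact norm_mul_le _ _

lemma sNumbers_mul_right_le (X B : H →L[ℂ] H) (n : ℕ) :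
    sNumbers (X * B) n ≤ ‖B‖ * sNumbers X n := by
  rcases (norm_nonneg B).eq_or_lt with hB | hB
  · rw [eq_comm, norm_eq_zero] at hB
    simp [hB, sNumbers_zero]
  · rw [← div_le_iff₀' hB]
    refine le_sNumbers X fun F hF => ?_
    rw [div_le_iff₀' hB, mul_comm]
    refine (sNumbers_le (X * B) (F := F * B) ?_).trans ?_
    · exact (LinearMap.rank_comp_le_left (B : H →ₗ[ℂ] H) (F : H →ₗ[ℂ] H)).trans hF
    · rw [← sub_mul]
      exact norm_mul_le _ _

lemma sNumbers_neg_le (X : H →L[ℂ] H) (n : ℕ) : sNumbers (-X) n ≤ sNumbers X n := by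
  refine le_sNumbers X fun F hF => ?_
  have : LinearMap.rank ((-F : H →L[ℂ] H) : H →ₗ[ℂ] H) = LinearMap.rank (F : H →ₗ[ℂ] H) := by
    unfold LinearMap.rank
    rw [ContinuousLinearMap.toLinearMap_neg, LinearMap.range_neg]
  refine (sNumbers_le (-X) (this.trans_le hF)).trans_eq ?_
  rw [← norm_neg]
  congr 1
  abel

/-- A crude form of Ky Fan's inequality; the factor 2 is harmless because the definition of the mean
ideal allows any constant. -/
lemma sum_sNumbers_add_le (X Y : H →L[ℂ] H) (n : ℕ) :
    ∑ i ∈ Finset.range n, sNumbers (X + Y) i ≤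
      ∑ i ∈ Finset.range n, 2 * sNumbers X i + ∑ i ∈ Finset.range n, 2 * sNumbers Y i := by
  calc ∑ i ∈ Finset.range n, sNumbers (X + Y) i
      ≤ ∑ i ∈ Finset.range n, (sNumbers X (i / 2) + sNumbers Y (i / 2)) :=
        Finset.sum_le_sum fun i _ => sNumbers_add_le_half X Y i
    _ ≤ _ := by
        rw [Finset.sum_add_distrib, ← Finset.mul_sum, ← Finset.mul_sum]
        exact add_le_add (sum_range_half_le (sNumbers_nonneg X) n)
          (sum_range_half_le (sNumbers_nonneg Y) n)

end SNumbers

/-! ### Estimating `s`-numbers through orthogonal systems -/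

section Orthogonal

variable {H : Type*} [NormedAddCommGroup H] [InnerProductSpace ℂ H]

lemma norm_sq_sum_smul {ι : Type*} {g : ι → H}
    (hg : ∀ i j, i ≠ j → inner ℂ (g i) (g j) = 0) (a : ι → ℂ) (s : Finset ι) :
    ‖∑ i ∈ s, a i • g i‖ ^ 2 = ∑ i ∈ s, ‖a i‖ ^ 2 * ‖g i‖ ^ 2 := by
  classical
  induction s using Finset.induction_on with
  | empty => simp
  | insert i s hi ih =>
    rw [Finset.sum_insert hi, Finset.sum_insert hi, ← ih, sq, sq (‖∑ i ∈ s, a i • g i‖),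
      norm_add_sq_eq_norm_sq_add_norm_sq_of_inner_eq_zero (𝕜 := ℂ), norm_smul]
    · ring
    · rw [inner_sum]
      refine Finset.sum_eq_zero fun j hj => ?_
      rw [inner_smul_left, inner_smul_right, hg i j (by rintro rfl; exact hi hj)]
      simp

/-- Pythagoras. The bound on `g i` is required only where `a i ≠ 0`, so vectors orthogonal to the
first `e i` avoid the large early terms. -/
lemma norm_sum_smul_le {ι : Type*} {g : ι → H}
    (hg : ∀ i j, i ≠ j → inner ℂ (g i) (g j) = 0) {e : ι → H} (he : Orthonormal ℂ e) {c : ℝ}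
    (hc : 0 ≤ c) (a : ι → ℂ) (s : Finset ι) (hs : ∀ i ∈ s, a i ≠ 0 → ‖g i‖ ≤ c) :
    ‖∑ i ∈ s, a i • g i‖ ≤ c * ‖∑ i ∈ s, a i • e i‖ := by
  refine le_of_sq_le_sq ?_ (by positivity)
  rw [mul_pow, norm_sq_sum_smul hg, norm_sq_sum_smul fun i j h => he.2 h, Finset.mul_sum]
  refine Finset.sum_le_sum fun i hi => ?_
  rcases eq_or_ne (a i) 0 with h0 | h0
  · simp [h0]
  · rw [he.1 i, one_pow, mul_one, mul_comm]
    have := hs i hi h0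
    gcongr

lemma le_norm_sum_smul {ι : Type*} {g : ι → H}
    (hg : ∀ i j, i ≠ j → inner ℂ (g i) (g j) = 0) {e : ι → H} (he : Orthonormal ℂ e) {c : ℝ}
    (hc : 0 ≤ c) (a : ι → ℂ) (s : Finset ι) (hs : ∀ i ∈ s, c ≤ ‖g i‖) :
    c * ‖∑ i ∈ s, a i • e i‖ ≤ ‖∑ i ∈ s, a i • g i‖ := by
  refine le_of_sq_le_sq ?_ (by positivity)
  rw [mul_pow, norm_sq_sum_smul hg, norm_sq_sum_smul fun i j h => he.2 h, Finset.mul_sum]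
  refine Finset.sum_le_sum fun i hi => ?_
  rw [he.1 i, one_pow, mul_one, mul_comm]
  have := hs i hi
  gcongr

/-- Lower bound for the `s`-numbers of an operator that maps an orthonormal system to an
orthogonal one. -/
lemma le_sNumbers_of_orthogonal {e : ℕ → H} (he : Orthonormal ℂ e) {Y : H →L[ℂ] H}
    (hY : ∀ i j, i ≠ j → inner ℂ (Y (e i)) (Y (e j)) = 0) {n : ℕ} {c : ℝ} (hc : 0 ≤ c)
    (hn : ∀ i ≤ n, c ≤ ‖Y (e i)‖) : c ≤ sNumbers Y n := by
  refine le_sNumbers Y fun F hF => ?_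
  let E : (Fin (n + 1) → ℂ) →ₗ[ℂ] H := Fintype.linearCombination ℂ fun i : Fin (n + 1) => e i
  have hE : ∀ a, E a = ∑ i : Fin (n + 1), a i • e i := fun a => rfl
  -- By dimension count `F`, of rank at most `n`, kills a nonzero vector in the span of `e 0, …, e
  -- n`. On that vector `Y - F` agrees with `Y`, which is bounded below by `c`.
  have hinj : ¬ Function.Injective ((F : H →ₗ[ℂ] H) ∘ₗ E) := by
    intro hinj
    have hmem : ∀ a, ((F : H →ₗ[ℂ] H) ∘ₗ E) a ∈ LinearMap.range (F : H →ₗ[ℂ] H) :=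
      fun a => LinearMap.mem_range_self _ _
    have h1 := LinearMap.lift_rank_le_of_injective
      (((F : H →ₗ[ℂ] H) ∘ₗ E).codRestrict _ hmem) fun a b hab => hinj (congrArg Subtype.val hab)
    rw [rank_fin_fun] at h1
    have h2 := (Cardinal.lift_le.2 hF).trans_eq (Cardinal.lift_natCast n)
    have h3 := h1.trans h2
    rw [Cardinal.lift_natCast, Nat.cast_le] at h3
    omega
  rw [← LinearMap.ker_eq_bot, Submodule.eq_bot_iff] at hinj
  push Not at hinj
  obtain ⟨a, ha, ha0⟩ := hinj
  have hFa : F (E a) = 0 := ha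
  have heF : Orthonormal ℂ fun i : Fin (n + 1) => e i := he.comp _ Fin.val_injective
  have hEa : E a ≠ 0 := by
    intro h0
    apply ha0
    have := Fintype.linearIndependent_iff.1 heF.linearIndependent a (by rw [← hE, h0])
    exact funext this
  have hlow : c * ‖E a‖ ≤ ‖Y (E a)‖ := by
    have := le_norm_sum_smul (g := fun i : Fin (n + 1) => Y (e i))
      (fun i j hij => hY i j (by simpa [Fin.val_inj] using hij)) heF hc a Finset.univ
      (fun i _ => hn i (by omega))
    rw [hE, map_sum]
    simpa only [map_smul] using this
  have hup : ‖Y (E a)‖ ≤ ‖Y - F‖ * ‖E a‖ := by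
    have := (Y - F).le_opNorm (E a)
    rwa [sub_apply, hFa, sub_zero] at this
  exact le_of_mul_le_mul_right (hlow.trans hup) (norm_pos_iff.2 hEa)

/-- Upper bound for the `s`-numbers from the norm on a subspace of codimension at most `n`. -/
lemma sNumbers_le_of_forall {e : ℕ → H} {Y : H →L[ℂ] H} {n : ℕ} {c : ℝ} (hc : 0 ≤ c)
    (h : ∀ w : H, (∀ i < n, inner ℂ (e i) w = 0) → ‖Y w‖ ≤ c * ‖w‖) : sNumbers Y n ≤ c := by
  let K : Submodule ℂ H := Submodule.span ℂ (e '' Set.Iio n)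
  have hfin : (e '' Set.Iio n).Finite := (Set.finite_Iio n).image e
  have : FiniteDimensional ℂ K := FiniteDimensional.span_of_finite ℂ hfin
  -- The approximant is `Y` composed with the projection onto the span of the first `n` vectors; the
  -- remainder sees only the orthogonal complement.
  have hrank : LinearMap.rank ((Y * K.starProjection : H →L[ℂ] H) : H →ₗ[ℂ] H)
      ≤ (n : Cardinal) := by
    refine (LinearMap.rank_comp_le_right (K.starProjection : H →ₗ[ℂ] H) (Y : H →ₗ[ℂ] H)).trans ?_
    have h1 : LinearMap.range (K.starProjection : H →ₗ[ℂ] H) = K := K.range_starProjection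
    unfold LinearMap.rank
    rw [h1]
    refine (rank_span_le _).trans ?_
    have h2 := Cardinal.mk_image_le_lift (f := e) (s := Set.Iio n)
    simpa using h2
  refine (sNumbers_le Y hrank).trans (ContinuousLinearMap.opNorm_le_bound _ hc fun w => ?_)
  have hw : w - K.starProjection w ∈ Kᗮ := K.sub_starProjection_mem_orthogonal w
  have e1 : (Y - Y * K.starProjection) w = Y (w - K.starProjection w) := by
    simp
  rw [e1]
  refine (h _ fun i hi => ?_).trans ?_
  · exact (Submodule.mem_orthogonal _ _).1 hw _ (Submodule.subset_span ⟨i, hi, rfl⟩)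
  · gcongr
    rw [← Submodule.starProjection_orthogonal_val]
    exact Submodule.norm_starProjection_apply_le _ _

end Orthogonal

/-! ### Diagonal operators and the Schmidt decomposition -/

section Hilbert

variable {H : Type*} [NormedAddCommGroup H] [InnerProductSpace ℂ H]

lemma norm_sum_inner_smul_le {e : ℕ → H} (he : Orthonormal ℂ e) (w : H) (s : Finset ℕ) :
    ‖∑ i ∈ s, inner ℂ (e i) w • e i‖ ≤ ‖w‖ := by
  refine le_of_sq_le_sq ?_ (norm_nonneg _)
  rw [norm_sq_sum_smul fun i j h => he.2 h]
  refine le_trans (le_of_eq ?_) (he.sum_inner_products_le w (s := s))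
  exact Finset.sum_congr rfl fun i _ => by rw [he.1 i, one_pow, mul_one]

lemma isCompactOperator_of_rank_le {F : H →L[ℂ] H} {n : ℕ}
    (hF : LinearMap.rank (F : H →ₗ[ℂ] H) ≤ (n : Cardinal)) : IsCompactOperator F := by
  have hfin : FiniteDimensional ℂ (LinearMap.range (F : H →ₗ[ℂ] H)) :=
    Module.rank_lt_aleph0_iff.1 (hF.trans_lt (Cardinal.natCast_lt_aleph0))
  have h1 : IsCompactOperator (id : LinearMap.range (F : H →ₗ[ℂ] H) → _) := isCompactOperator_id
  have h2 := (h1.comp_clm (F.codRestrict (LinearMap.range (F : H →ₗ[ℂ] H))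
    fun x => LinearMap.mem_range_self _ x)).clm_comp
    (LinearMap.range (F : H →ₗ[ℂ] H)).subtypeL
  exact h2

variable [CompleteSpace H]

lemma summable_mul_inner_smul {e : ℕ → H} (he : Orthonormal ℂ e) {c : ℕ → ℝ} {C : ℝ}
    (hc0 : ∀ n, 0 ≤ c n) (hcC : ∀ n, c n ≤ C) (w : H) :
    Summable fun i => ((c i : ℂ) * inner ℂ (e i) w) • e i := by
  have h := he.orthogonalFamily.summable_iff_norm_sq_summable
    (fun i => (c i : ℂ) * inner ℂ (e i) w)
  refine h.2 (Summable.of_nonneg_of_le (fun i => by positivity) (fun i => ?_)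
    ((he.inner_products_summable w).mul_left (C ^ 2)))
  rw [norm_mul, mul_pow, Complex.norm_real, Real.norm_of_nonneg (hc0 i)]
  have := hc0 i
  have := hcC i
  gcongr

lemma summable_inner_smul {e : ℕ → H} (he : Orthonormal ℂ e) (w : H) :
    Summable fun i => inner ℂ (e i) w • e i := by
  simpa using summable_mul_inner_smul he (c := fun _ => 1) (C := 1) (by simp) (by simp) w

/-- The `s`-numbers of an operator that maps an orthonormal system to an orthogonal one with
decreasing norms, and vanishes on the orthogonal complement of the system. -/
theorem sNumbers_eq_of_orthogonal {e : ℕ → H} (he : Orthonormal ℂ e) {Y : H →L[ℂ] H}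
    (hY : ∀ i j, i ≠ j → inner ℂ (Y (e i)) (Y (e j)) = 0) {c : ℕ → ℝ} (hc : Antitone c)
    (hc0 : ∀ n, 0 ≤ c n) (hn : ∀ i, ‖Y (e i)‖ = c i)
    (h0 : ∀ w, (∀ i, inner ℂ (e i) w = 0) → Y w = 0) : sNumbers Y = c := by
  funext n
  refine le_antisymm (sNumbers_le_of_forall (e := e) (hc0 n) fun w hw => ?_)
    (le_sNumbers_of_orthogonal he hY (hc0 n) fun i hi => (hc hi).trans_eq (hn i).symm)
  obtain ⟨u, hu⟩ := summable_inner_smul he w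
  -- `u` is the projection of `w` onto the closed span of `e`, so `w - u` is orthogonal to every `e
  -- i`.
  have hYw : Y w = Y u := by
    rw [← sub_eq_zero, ← map_sub]
    refine h0 _ fun i => ?_
    rw [inner_sub_right, sub_eq_zero]
    have h1 := (innerSL ℂ (e i)).hasSum hu
    refine HasSum.unique ?_ h1
    have h2 : ∀ j, j ≠ i → (innerSL ℂ (e i)) (inner ℂ (e j) w • e j) = 0 := by
      intro j hj
      rw [innerSL_apply_apply, inner_smul_right, he.2 hj.symm, mul_zero]
    have h3 := hasSum_single i h2
    rw [innerSL_apply_apply, inner_smul_right, inner_self_eq_norm_sq_to_K, he.1 i] at h3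
    simpa using h3
  rw [hYw]
  have h1 := Y.hasSum hu
  refine le_of_tendsto h1.norm (Eventually.of_forall fun s => ?_)
  have h2 := norm_sum_smul_le (g := fun i => Y (e i)) hY he (hc0 n)
    (fun i => inner ℂ (e i) w) s fun i _ hi => by
      rw [hn]
      refine hc (not_lt.1 fun hin => hi (hw i hin))
  simp only [map_smul]
  exact h2.trans (mul_le_mul_of_nonneg_left (norm_sum_inner_smul_le he w s) (hc0 n))

/-- Diagonal operators with respect to an orthonormal sequence. -/
theorem exists_diagonal {e : ℕ → H} (he : Orthonormal ℂ e) {c : ℕ → ℝ} {C : ℝ}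
    (hc0 : ∀ n, 0 ≤ c n) (hcC : ∀ n, c n ≤ C) :
    ∃ E : H →L[ℂ] H, (∀ n, E (e n) = (c n : ℂ) • e n) ∧
      ∀ w, (∀ i, inner ℂ (e i) w = 0) → E w = 0 := by
  have hC : 0 ≤ C := (hc0 0).trans (hcC 0)
  have hs := summable_mul_inner_smul he hc0 hcC
  let E : H →ₗ[ℂ] H :=
    { toFun := fun w => ∑' i, ((c i : ℂ) * inner ℂ (e i) w) • e i
      map_add' := fun v w => by
        rw [← (hs v).tsum_add (hs w)]
        simp only [inner_add_right, mul_add, add_smul]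
      map_smul' := fun a w => by
        rw [RingHom.id_apply, ← (hs w).tsum_const_smul]
        refine tsum_congr fun i => ?_
        rw [inner_smul_right, smul_smul]
        congr 1
        ring }
  have hbound : ∀ w, ‖E w‖ ≤ C * ‖w‖ := by
    intro w
    refine le_of_tendsto (hs w).hasSum.norm (Eventually.of_forall fun s => ?_)
    have h2 := norm_sum_smul_le (g := fun i => (c i : ℂ) • e i)
      (fun i j hij => by rw [inner_smul_left, inner_smul_right, he.2 hij]; simp) he hC
      (fun i => inner ℂ (e i) w) s fun i _ _ => by
        rw [norm_smul, he.1 i, mul_one, Complex.norm_real, Real.norm_of_nonneg (hc0 i)]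
        exact hcC i
    refine le_trans (le_of_eq ?_)
      (h2.trans (mul_le_mul_of_nonneg_left (norm_sum_inner_smul_le he w s) hC))
    refine congrArg norm (Finset.sum_congr rfl fun i _ => ?_)
    rw [smul_smul, mul_comm]
  refine ⟨E.mkContinuous C hbound, fun n => ?_, fun w hw => ?_⟩
  · show ∑' i, ((c i : ℂ) * inner ℂ (e i) (e n)) • e i = _
    rw [tsum_eq_single n]
    · rw [inner_self_eq_norm_sq_to_K, he.1 n]
      simp
    · intro j hj
      rw [he.2 hj, mul_zero, zero_smul]
  · show ∑' i, ((c i : ℂ) * inner ℂ (e i) w) • e i = _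
    simp [hw]

lemma isCompactOperator_of_tendsto_sNumbers {X : H →L[ℂ] H}
    (hX : Tendsto (sNumbers X) atTop (𝓝 0)) : IsCompactOperator X := by
  have hpos : ∀ n : ℕ, sNumbers X n < sNumbers X n + 1 / ((n : ℝ) + 1) := fun n =>
    lt_add_of_pos_right _ (by positivity)
  choose F hF hF' using fun n => exists_norm_sub_lt X (hpos n)
  refine isCompactOperator_of_tendsto (F := F) (l := atTop) ?_
    (Eventually.of_forall fun n => isCompactOperator_of_rank_le (hF n))
  rw [tendsto_iff_norm_sub_tendsto_zero]
  refine squeeze_zero (fun n => norm_nonneg _) (fun n => ?_)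
    (by simpa only [add_zero] using hX.add (tendsto_one_div_add_atTop_nhds_zero_nat (𝕜 := ℝ)))
  rw [norm_sub_rev]
  exact (hF' n).le

/-- A compact operator attains its norm on every nonzero closed subspace, at a vector whose image
is orthogonal to the image of its orthogonal complement in the subspace. -/
lemma exists_norm_maximizer {X : H →L[ℂ] H} (hX : IsCompactOperator X) (M : Submodule ℂ H)
    (hM : IsClosed (M : Set H)) (hne : M ≠ ⊥) :
    ∃ v ∈ M, ‖v‖ = 1 ∧ (∀ w ∈ M, ‖X w‖ ≤ ‖X v‖ * ‖w‖) ∧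
      ∀ w ∈ M, inner ℂ v w = 0 → inner ℂ (X v) (X w) = 0 := by
  have : CompleteSpace M := hM.completeSpace_coe
  have hnt : Nontrivial M := Submodule.nontrivial_iff_ne_bot.2 hne
  set A : M →L[ℂ] H := X ∘L M.subtypeL with hA
  set T : M →L[ℂ] M := ContinuousLinearMap.adjoint A ∘L A with hT
  have hTc : IsCompactOperator T := (hX.comp_clm M.subtypeL).clm_comp (ContinuousLinearMap.adjoint A)
  have hTs : IsSelfAdjoint T := (ContinuousLinearMap.isPositive_adjoint_comp_self A).isSelfAdjoint
  have hTn : ‖T‖ = ‖A‖ * ‖A‖ := ContinuousLinearMap.norm_adjoint_comp_self A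
  have hTi : ∀ v w : M, inner ℂ (A v) (A w) = inner ℂ (T v) w := fun v w =>
    (ContinuousLinearMap.adjoint_inner_left A w (A v)).symm
  obtain ⟨u, hu1, huA, huo⟩ : ∃ u : M, ‖u‖ = 1 ∧ ‖A u‖ = ‖A‖ ∧
      ∀ w : M, inner ℂ u w = 0 → inner ℂ (A u) (A w) = 0 := by
    rcases eq_or_ne A 0 with h0 | h0
    · obtain ⟨u, hu⟩ := exists_norm_eq M (zero_le_one (α := ℝ))
      exact ⟨u, hu, by rw [h0, zero_apply, norm_zero]; exact ContinuousLinearMap.opNorm_zero.symm, fun w _ => by simp [h0]⟩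
    -- `T = A*A` is compact and self-adjoint, so some spectral value has modulus `‖T‖ = ‖A‖²`; being
    -- nonzero, it is an eigenvalue. Its eigenvector `v` attains the norm of `A`, and `⟨Av, Aw⟩ =
    -- ⟨Tv, w⟩` gives the orthogonality.
    · obtain ⟨k, hk, hkn⟩ := spectrum.exists_nnnorm_eq_spectralRadius T
      rw [ContinuousLinearMap.spectralRadius_eq_nnnorm T hTs, ENNReal.coe_inj] at hkn
      have hkn' : ‖k‖ = ‖A‖ * ‖A‖ := (congrArg NNReal.toReal hkn).trans hTn
      have hk0 : k ≠ 0 := by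
        rintro rfl
        rw [norm_zero, eq_comm, mul_self_eq_zero] at hkn'
        exact h0 (A.opNorm_zero_iff.1 hkn')
      obtain ⟨v, hv⟩ := ((hTc.hasEigenvalue_iff_mem_spectrum hk0).2 hk).exists_hasEigenvector
      have hv0 : v ≠ 0 := hv.2
      have hTv : T v = k • v := hv.apply_eq_smul
      have hort : ∀ w : M, inner ℂ v w = 0 → inner ℂ (A v) (A w) = 0 := by
        intro w hw
        rw [hTi, hTv, inner_smul_left, hw, mul_zero]
      have hnv : ‖A v‖ = ‖A‖ * ‖v‖ := by
        have h1 : ‖inner ℂ (A v) (A v)‖ = ‖inner ℂ (T v) v‖ := congrArg norm (hTi v v)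
        rw [hTv, inner_smul_left, norm_mul, RCLike.norm_conj, hkn',
          inner_self_eq_norm_sq_to_K, inner_self_eq_norm_sq_to_K, norm_pow, norm_pow,
          RCLike.norm_ofReal, RCLike.norm_ofReal, abs_norm, abs_norm] at h1
        refine (pow_left_inj₀ (norm_nonneg _) (by positivity) two_ne_zero).1 ?_
        rw [h1]
        ring
      refine ⟨(‖v‖⁻¹ : ℂ) • v, ?_, ?_, ?_⟩
      · rw [norm_smul]
        simp [hv0]
      · have : ‖v‖ ≠ 0 := norm_ne_zero_iff.2 hv0
        rw [map_smul, norm_smul, hnv, norm_inv, Complex.norm_real, norm_norm]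
        field_simp
      · intro w hw
        rw [inner_smul_left, mul_eq_zero] at hw
        rw [map_smul, inner_smul_left, hort w (hw.resolve_left (by simpa using hv0)), mul_zero]
  refine ⟨u, u.2, hu1, fun w hw => ?_, fun w hw h => huo ⟨w, hw⟩ h⟩
  have := A.le_opNorm ⟨w, hw⟩
  rw [← huA] at this
  exact this

/-- **Schmidt decomposition**: an operator whose `s`-numbers tend to `0` maps some orthonormal
sequence to an orthogonal sequence whose norms are the `s`-numbers, and vanishes on its orthogonal
complement. -/
theorem exists_schmidt (hH : ¬ FiniteDimensional ℂ H) {X : H →L[ℂ] H}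
    (hX : Tendsto (sNumbers X) atTop (𝓝 0)) :
    ∃ e : ℕ → H, Orthonormal ℂ e ∧ (∀ i j, i ≠ j → inner ℂ (X (e i)) (X (e j)) = 0) ∧
      (∀ n, ‖X (e n)‖ = sNumbers X n) ∧ ∀ w, (∀ i, inner ℂ (e i) w = 0) → X w = 0 := by
  have hXc := isCompactOperator_of_tendsto_sNumbers hX
  -- `p` is total but meaningful only on closed nonzero subspaces, so the greedy recursion can be
  -- set up before `hMgood` shows that it never leaves them.
  choose! p hpM hp1 hpmax hport using
    fun (M : Submodule ℂ H) (h : IsClosed (M : Set H) ∧ M ≠ ⊥) =>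
      exists_norm_maximizer hXc M h.1 h.2
  obtain ⟨M, hM0, hMs⟩ : ∃ M : ℕ → Submodule ℂ H,
      M 0 = ⊤ ∧ ∀ n, M (n + 1) = M n ⊓ (ℂ ∙ p (M n))ᗮ :=
    ⟨fun n => Nat.rec ⊤ (fun _ N => N ⊓ (ℂ ∙ p N)ᗮ) n, rfl, fun _ => rfl⟩
  set e : ℕ → H := fun n => p (M n) with he
  have hMe : ∀ n w, w ∈ M n ↔ ∀ i < n, inner ℂ (e i) w = 0 := by
    intro n w
    induction n with
    | zero => simp [hM0]
    | succ n ih =>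
      rw [hMs, Submodule.mem_inf, ih, Submodule.mem_orthogonal_singleton_iff_inner_right]
      constructor
      · rintro ⟨h1, h2⟩ i hi
        rcases Nat.lt_succ_iff_lt_or_eq.1 hi with h | rfl
        · exact h1 i h
        · exact h2
      · exact fun h => ⟨fun i hi => h i (by omega), h n (by omega)⟩
  have hMspan : ∀ n, M n = (Submodule.span ℂ (e '' Set.Iio n))ᗮ := by
    intro n
    ext w
    rw [hMe, Submodule.mem_orthogonal]
    constructor
    · intro h u hu
      induction hu using Submodule.span_induction with
      | mem x hx => obtain ⟨i, hi, rfl⟩ := hx; exact h i hi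
      | zero => simp
      | add x y _ _ hx hy => rw [inner_add_left, hx, hy, add_zero]
      | smul a x _ hx => rw [inner_smul_left, hx, mul_zero]
    · exact fun h i hi => h _ (Submodule.subset_span ⟨i, hi, rfl⟩)
  have hMgood : ∀ n : ℕ, IsClosed (M n : Set H) ∧ M n ≠ ⊥ := by
    intro n
    have hfin : FiniteDimensional ℂ (Submodule.span ℂ (e '' Set.Iio n)) :=
      FiniteDimensional.span_of_finite ℂ ((Set.finite_Iio n).image e)
    rw [hMspan]
    refine ⟨Submodule.isClosed_orthogonal _, fun hbot => hH ?_⟩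
    -- A zero `M n` would make `H` the span of finitely many vectors.
    rw [Submodule.orthogonal_eq_bot_iff] at hbot
    exact Module.finite_def.2 (hbot ▸ Module.Finite.iff_fg.1 hfin)
  have horth : Orthonormal ℂ e := by
    refine ⟨fun n => hp1 _ (hMgood n), ?_⟩
    have hlt : ∀ i j, i < j → inner ℂ (e i) (e j) = 0 := fun i j hij =>
      (hMe j (e j)).1 (hpM _ (hMgood j)) i hij
    intro i j hij
    rcases lt_or_gt_of_ne hij with h | h
    · exact hlt i j h
    · exact inner_eq_zero_symm.1 (hlt j i h)
  have hXlt : ∀ i j, i < j → inner ℂ (X (e i)) (X (e j)) = 0 := fun i j hij =>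
    hport _ (hMgood i) _ ((hMe i _).2 fun k hk => horth.2 (by omega)) (horth.2 hij.ne)
  have hXo : ∀ i j, i ≠ j → inner ℂ (X (e i)) (X (e j)) = 0 := by
    intro i j hij
    rcases lt_or_gt_of_ne hij with h | h
    · exact hXlt i j h
    · exact inner_eq_zero_symm.1 (hXlt j i h)
  have hmax : ∀ n w, (∀ i < n, inner ℂ (e i) w = 0) → ‖X w‖ ≤ ‖X (e n)‖ * ‖w‖ := fun n w hw =>
    hpmax _ (hMgood n) w ((hMe n w).2 hw)
  have hs : ∀ n, ‖X (e n)‖ = sNumbers X n := by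
    intro n
    refine le_antisymm (le_sNumbers_of_orthogonal horth hXo (norm_nonneg _) fun i hi => ?_)
      (sNumbers_le_of_forall (norm_nonneg _) (hmax n))
    have := hmax i (e n) fun k hk => horth.2 (by omega)
    rwa [horth.1 n, mul_one] at this
  refine ⟨e, horth, hXo, hs, fun w hw => ?_⟩
  have h1 : ∀ n, ‖X w‖ ≤ sNumbers X n * ‖w‖ := fun n => hs n ▸ hmax n w fun i _ => hw i
  have h2 : ‖X w‖ ≤ 0 * ‖w‖ := ge_of_tendsto' (hX.mul_const ‖w‖) h1
  rw [zero_mul] at h2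
  exact norm_le_zero_iff.1 h2

end Hilbert

/-! ### From sequences to ideals -/

section Calkin

variable {H : Type*} [NormedAddCommGroup H] [InnerProductSpace ℂ H]

lemma charSet_mono {I J : TwoSidedIdeal (H →L[ℂ] H)} (h : I ≤ J) : charSet I ⊆ charSet J := by
  rintro _ ⟨X, hX, rfl⟩
  exact ⟨X, h hX, rfl⟩

lemma idealOf_mono {S T : Set (ℕ → ℝ)} (h : S ⊆ T) : idealOf H S ≤ idealOf H T :=
  TwoSidedIdeal.span_mono fun _ hX => h hX

lemma meanIdeal_mono {I J : TwoSidedIdeal (H →L[ℂ] H)} (h : I ≤ J) :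
    meanIdeal I ≤ meanIdeal J :=
  idealOf_mono fun _ ⟨h1, η, hη, hC⟩ => ⟨h1, η, charSet_mono h hη, hC⟩

lemma preMeanIdeal_mono {I J : TwoSidedIdeal (H →L[ℂ] H)} (h : I ≤ J) :
    preMeanIdeal I ≤ preMeanIdeal J :=
  idealOf_mono fun _ hξ => ⟨hξ.1, charSet_mono h hξ.2⟩

lemma amClosure_mono {I J : TwoSidedIdeal (H →L[ℂ] H)} (h : I ≤ J) :
    amClosure I ≤ amClosure J :=
  preMeanIdeal_mono (meanIdeal_mono h)

variable [CompleteSpace H]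

/-- A splitting of the `s`-number sequence of a compact operator into decreasing nonnegative
sequences lifts to a splitting of the operator. -/
theorem exists_add_eq_of_sNumbers (hH : ¬ FiniteDimensional ℂ H) {X : H →L[ℂ] H}
    (hX : Tendsto (sNumbers X) atTop (𝓝 0)) {ζ τ : ℕ → ℝ} (hζ : Antitone ζ) (hτ : Antitone τ)
    (hζ0 : ∀ n, 0 ≤ ζ n) (hτ0 : ∀ n, 0 ≤ τ n) (hadd : ∀ n, ζ n + τ n = sNumbers X n) :
    ∃ Y Z : H →L[ℂ] H, Y + Z = X ∧ sNumbers Y = ζ ∧ sNumbers Z = τ := by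
  obtain ⟨e, he, hXo, hXn, hX0⟩ := exists_schmidt hH hX
  have hsX := sNumbers_nonneg X
  have hζle : ∀ n, ζ n ≤ sNumbers X n := fun n => by linarith [hadd n, hτ0 n]
  -- `X * E` and `X * (1 - E)` rescale the images `X (e n)` to norms `ζ n` and `τ n`. Where `s_n(X)
  -- = 0` the quotient is `0`, consistently, since then `ζ n = 0`.
  obtain ⟨E, hE, hE0⟩ := exists_diagonal he (c := fun n => ζ n / sNumbers X n) (C := 1)
    (fun n => div_nonneg (hζ0 n) (hsX n)) fun n => div_le_one_of_le₀ (hζle n) (hsX n)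
  have hY : ∀ n, (X * E) (e n) = ((ζ n / sNumbers X n : ℝ) : ℂ) • X (e n) := fun n => by
    rw [show (X * E) (e n) = X (E (e n)) from rfl, hE, map_smul]
  have hZ : ∀ n, (X - X * E) (e n) = ((1 - ζ n / sNumbers X n : ℝ) : ℂ) • X (e n) := fun n => by
    rw [sub_apply, hY, Complex.ofReal_sub, sub_smul, Complex.ofReal_one, one_smul]
  have hYn : ∀ n, ζ n / sNumbers X n * sNumbers X n = ζ n := fun n => by
    rcases eq_or_ne (sNumbers X n) 0 with h | h
    · rw [h, mul_zero]
      exact le_antisymm (hζ0 n) (h ▸ hζle n)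
    · exact div_mul_cancel₀ _ h
  have hYw : ∀ w, (∀ i, inner ℂ (e i) w = 0) → (X * E) w = 0 := fun w hw => by
    rw [show (X * E) w = X (E w) from rfl, hE0 w hw, map_zero]
  refine ⟨X * E, X - X * E, by abel, ?_, ?_⟩
  · refine sNumbers_eq_of_orthogonal he (fun i j hij => ?_) hζ hζ0 (fun n => ?_) hYw
    · rw [hY, hY, inner_smul_left, inner_smul_right, hXo i j hij, mul_zero, mul_zero]
    · rw [hY, norm_smul, Complex.norm_real, hXn,
        Real.norm_of_nonneg (div_nonneg (hζ0 n) (hsX n)), hYn]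
  · refine sNumbers_eq_of_orthogonal he (fun i j hij => ?_) hτ hτ0 (fun n => ?_) fun w hw => ?_
    · rw [hZ, hZ, inner_smul_left, inner_smul_right, hXo i j hij, mul_zero, mul_zero]
    · rw [hZ, norm_smul, Complex.norm_real, hXn, Real.norm_of_nonneg
        (sub_nonneg.2 (div_le_one_of_le₀ (hζle n) (hsX n))), sub_mul, hYn, one_mul]
      linarith [hadd n]
    · rw [sub_apply, hYw w hw, hX0 w hw, sub_zero]

/-- Every sequence in `c_o^*` is the `s`-number sequence of an operator. -/
theorem exists_sNumbers_eq (hH : ¬ FiniteDimensional ℂ H) {ξ : ℕ → ℝ} (hξ : ξ ∈ c0Star) :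
    ∃ X : H →L[ℂ] H, sNumbers X = ξ := by
  -- Applied to the zero operator merely to obtain an orthonormal sequence.
  obtain ⟨e, he, -⟩ := exists_schmidt hH (X := (0 : H →L[ℂ] H))
    (tendsto_const_nhds.congr fun n => (sNumbers_zero n).symm)
  obtain ⟨E, hE, hE0⟩ := exists_diagonal he hξ.2.1 fun n => hξ.1 (Nat.zero_le n)
  refine ⟨E, sNumbers_eq_of_orthogonal he (fun i j hij => ?_) hξ.1 hξ.2.1 (fun n => ?_) hE0⟩
  · rw [hE, hE, inner_smul_left, inner_smul_right, he.2 hij, mul_zero, mul_zero]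
  · rw [hE, norm_smul, Complex.norm_real, he.1 n, mul_one, Real.norm_of_nonneg (hξ.2.1 n)]

/-- An infinite-dimensional Hilbert space carries two isometries with orthogonal ranges. -/
lemma exists_isometries_orthogonal_range (hH : ¬ FiniteDimensional ℂ H) :
    ∃ U V : H →ₗᵢ[ℂ] H, ∀ x y, inner ℂ (U x) (V y) = 0 := by
  obtain ⟨w, b, -⟩ := exists_hilbertBasis ℂ H
  have hw : Infinite w := by
    by_contra hfin
    rw [not_infinite_iff_finite] at hfin
    have := Fintype.ofFinite w
    exact hH b.toOrthonormalBasis.toBasis.finiteDimensional_of_finite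
  -- An infinite basis splits into two parts, each equinumerous with the whole.
  obtain ⟨σ⟩ : Nonempty (w ⊕ w ≃ w) := by
    rw [← Cardinal.eq, Cardinal.mk_sum, Cardinal.lift_id,
      Cardinal.add_eq_self (Cardinal.aleph0_le_mk w)]
  have hU : Orthonormal ℂ fun i => b (σ (Sum.inl i)) :=
    b.orthonormal.comp _ (σ.injective.comp Sum.inl_injective)
  have hV : Orthonormal ℂ fun i => b (σ (Sum.inr i)) :=
    b.orthonormal.comp _ (σ.injective.comp Sum.inr_injective)
  refine ⟨hU.orthogonalFamily.linearIsometry.comp b.repr.toLinearIsometry,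
    hV.orthogonalFamily.linearIsometry.comp b.repr.toLinearIsometry, fun x y => ?_⟩
  have h1 := hU.orthogonalFamily.hasSum_linearIsometry (b.repr x)
  have h2 := hV.orthogonalFamily.hasSum_linearIsometry (b.repr y)
  have h3 : ∀ j z, inner ℂ (b (σ (Sum.inl j)))
      (hV.orthogonalFamily.linearIsometry z) = 0 := by
    intro j z
    have h4 := (innerSL ℂ (b (σ (Sum.inl j)))).hasSum
      (hV.orthogonalFamily.hasSum_linearIsometry z)
    refine h4.unique ?_
    convert! hasSum_zero with i
    rw [innerSL_apply_apply, LinearIsometry.toSpanSingleton_apply, inner_smul_right,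
      b.orthonormal.2 (fun h => by simpa using σ.injective h), mul_zero]
  have h5 := (innerSL ℂ (hV.orthogonalFamily.linearIsometry (b.repr y))).hasSum h1
  refine inner_eq_zero_symm.1 (h5.unique ?_)
  convert! hasSum_zero with i
  rw [innerSL_apply_apply, LinearIsometry.toSpanSingleton_apply, inner_smul_right,
    inner_eq_zero_symm.1 (h3 i _), mul_zero]

lemma sNumbers_le_of_compression {U : H →ₗᵢ[ℂ] H} {A D : H →L[ℂ] H}
    (h : ContinuousLinearMap.adjoint U.toContinuousLinearMap * (D * U.toContinuousLinearMap) = A)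
    (n : ℕ) : sNumbers A n ≤ sNumbers D n := by
  have hU : ‖U.toContinuousLinearMap‖ ≤ 1 := U.norm_toContinuousLinearMap_le
  have hU' : ‖ContinuousLinearMap.adjoint U.toContinuousLinearMap‖ ≤ 1 := by
    rwa [LinearIsometryEquiv.norm_map]
  rw [← h]
  refine (sNumbers_mul_left_le _ _ n).trans ?_
  refine (mul_le_of_le_one_left (sNumbers_nonneg _ n) hU').trans ?_
  exact (sNumbers_mul_right_le _ _ n).trans
    (mul_le_of_le_one_left (sNumbers_nonneg _ n) hU)

/-- Characteristic sets of ideals are directed. -/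
lemma exists_mem_sNumbers_le (hH : ¬ FiniteDimensional ℂ H) {I : TwoSidedIdeal (H →L[ℂ] H)}
    {A B : H →L[ℂ] H} (hA : A ∈ I) (hB : B ∈ I) :
    ∃ D ∈ I, (∀ n, sNumbers A n ≤ sNumbers D n) ∧ ∀ n, sNumbers B n ≤ sNumbers D n := by
  obtain ⟨U, V, hUV⟩ := exists_isometries_orthogonal_range hH
  set u := U.toContinuousLinearMap with hu
  set v := V.toContinuousLinearMap with hv
  -- `D` is an orthogonal direct sum of copies of `A` and `B` inside `H`; compressing by `U` or `V`
  -- recovers each.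
  set D : H →L[ℂ] H := u * (A * ContinuousLinearMap.adjoint u)
    + v * (B * ContinuousLinearMap.adjoint v) with hD
  have huu : ∀ x, ContinuousLinearMap.adjoint u (u x) = x := fun x =>
    ext_inner_right ℂ fun y => by
      rw [ContinuousLinearMap.adjoint_inner_left]
      exact U.inner_map_map x y
  have hvv : ∀ x, ContinuousLinearMap.adjoint v (v x) = x := fun x =>
    ext_inner_right ℂ fun y => by
      rw [ContinuousLinearMap.adjoint_inner_left]
      exact V.inner_map_map x y
  have huv : ∀ x, ContinuousLinearMap.adjoint v (u x) = 0 := fun x =>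
    ext_inner_right ℂ fun y => by
      rw [ContinuousLinearMap.adjoint_inner_left, inner_zero_left]
      exact hUV x y
  have hvu : ∀ x, ContinuousLinearMap.adjoint u (v x) = 0 := fun x =>
    ext_inner_right ℂ fun y => by
      rw [ContinuousLinearMap.adjoint_inner_left, inner_zero_left]
      exact inner_eq_zero_symm.1 (hUV y x)
  refine ⟨D, I.add_mem (I.mul_mem_left _ _ (I.mul_mem_right _ _ hA))
    (I.mul_mem_left _ _ (I.mul_mem_right _ _ hB)),
    sNumbers_le_of_compression (U := U) ?_, sNumbers_le_of_compression (U := V) ?_⟩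
  · ext x
    simp [hD, ← hu, huu, huv]
  · ext x
    simp [hD, ← hv, hvv, hvu]

/-- The `s`-numbers of the operators in `I_a` are dominated by arithmetic means of `s`-numbers of
operators in `I`. -/
theorem exists_le_mul_arithMean_of_mem_meanIdeal (hH : ¬ FiniteDimensional ℂ H)
    {I : TwoSidedIdeal (H →L[ℂ] H)} {Z : H →L[ℂ] H} (hZ : Z ∈ meanIdeal I) :
    ∃ A ∈ I, ∃ C : ℝ, 0 ≤ C ∧ ∀ n, sNumbers Z n ≤ C * arithMean (sNumbers A) n := by
  unfold meanIdeal idealOf at hZ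
  have hm : ∀ (A : H →L[ℂ] H) n, 0 ≤ arithMean (sNumbers A) n := fun A =>
    arithMean_nonneg (sNumbers_nonneg A)
  induction hZ using TwoSidedIdeal.span_induction with
  | mem X hX =>
    obtain ⟨-, _, ⟨A, hA, rfl⟩, C, hC⟩ := hX
    exact ⟨A, hA, max C 0, le_max_right _ _, fun n =>
      (hC n).trans (mul_le_mul_of_nonneg_right (le_max_left _ _) (hm A n))⟩
  | zero => exact ⟨0, I.zero_mem, 0, le_rfl, fun n => by rw [sNumbers_zero, zero_mul]⟩
  | add X Y _ _ hX hY =>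
    obtain ⟨A, hA, C, hC, h⟩ := hX
    obtain ⟨B, hB, C', hC', h'⟩ := hY
    obtain ⟨D, hD, hAD, hBD⟩ := exists_mem_sNumbers_le hH hA hB
    -- The factor 2 pays for passing from index `n / 2` back to `n`.
    refine ⟨D, hD, 2 * (C + C'), by positivity, fun n => ?_⟩
    have h1 := sNumbers_add_le_half X Y n
    have h2 := (h (n / 2)).trans (mul_le_mul_of_nonneg_left (arithMean_mono hAD _) hC)
    have h3 := (h' (n / 2)).trans (mul_le_mul_of_nonneg_left (arithMean_mono hBD _) hC')
    have h4 := mul_le_mul_of_nonneg_left (arithMean_half_le (sNumbers_nonneg D) n)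
      (add_nonneg hC hC')
    linarith
  | neg X _ hX =>
    obtain ⟨A, hA, C, hC, h⟩ := hX
    exact ⟨A, hA, C, hC, fun n => (sNumbers_neg_le X n).trans (h n)⟩
  | left_absorb T X _ hX =>
    obtain ⟨A, hA, C, hC, h⟩ := hX
    refine ⟨A, hA, ‖T‖ * C, by positivity, fun n => (sNumbers_mul_left_le T X n).trans ?_⟩
    rw [mul_assoc]
    exact mul_le_mul_of_nonneg_left (h n) (norm_nonneg T)
  | right_absorb T X _ hX =>
    obtain ⟨A, hA, C, hC, h⟩ := hX
    refine ⟨A, hA, ‖T‖ * C, by positivity, fun n => (sNumbers_mul_right_le X T n).trans ?_⟩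
    rw [mul_assoc]
    exact mul_le_mul_of_nonneg_left (h n) (norm_nonneg T)

/-- The mean of `s(Y)` lies in `c0Star`, so some operator `W` realizes it. The partial-sum bound
makes `W` a generator of the mean ideal, and hence `Y` a generator of the closure. -/
lemma mem_amClosure_of_sum_le (hH : ¬ FiniteDimensional ℂ H) {I : TwoSidedIdeal (H →L[ℂ] H)}
    {A Y : H →L[ℂ] H} (hA : A ∈ I) (hY : sNumbers Y ∈ c0Star) {C : ℝ}
    (h : ∀ n, ∑ i ∈ Finset.range n, sNumbers Y i ≤ C * ∑ i ∈ Finset.range n, sNumbers A i) :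
    Y ∈ amClosure I := by
  refine TwoSidedIdeal.subset_span ⟨hY, ?_⟩
  have hmean := arithMean_mem_c0Star hY
  obtain ⟨W, hW⟩ := exists_sNumbers_eq hH hmean
  refine ⟨W, TwoSidedIdeal.subset_span ?_, hW⟩
  rw [Set.mem_ofPred_eq, hW]
  exact ⟨hmean, _, ⟨A, hA, rfl⟩, C, fun n => arithMean_le_mul_iff.2 (h (n + 1))⟩

theorem amClosure_sup_le (hH : ¬ FiniteDimensional ℂ H) (I J : TwoSidedIdeal (H →L[ℂ] H)) :
    amClosure (I ⊔ J) ≤ amClosure I ⊔ amClosure J := by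
  refine TwoSidedIdeal.span_le.2 ?_
  rintro X ⟨hX, Z, hZ, hZX⟩
  obtain ⟨A, hA, C, hC, hle⟩ := exists_le_mul_arithMean_of_mem_meanIdeal hH hZ
  obtain ⟨B, hB, D, hD, rfl⟩ := TwoSidedIdeal.mem_sup.1 hA
  -- `C` comes from the domination by a mean, 2 from splitting the `s`-numbers of `B + D`.
  have hsum : ∀ n, ∑ i ∈ Finset.range n, sNumbers X i ≤
      ∑ i ∈ Finset.range n, 2 * C * sNumbers B i + ∑ i ∈ Finset.range n, 2 * C * sNumbers D i := by
    intro n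
    cases n with
    | zero => simp
    | succ n =>
      have h1 := hle n
      rw [hZX, arithMean_le_mul_iff] at h1
      refine (h1.trans (mul_le_mul_of_nonneg_left (sum_sNumbers_add_le B D _) hC)).trans_eq ?_
      simp only [← Finset.mul_sum]
      ring
  have hC2 : 0 ≤ 2 * C := by positivity
  obtain ⟨ζ, τ, hζ, hτ, hζ0, hτ0, hadd, hζB, hτD⟩ := exists_add_eq_of_sum_le hX.1
    ((sNumbers_antitone B).const_mul hC2) ((sNumbers_antitone D).const_mul hC2) hX.2.1
    (fun n => mul_nonneg hC2 (sNumbers_nonneg B n))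
    (fun n => mul_nonneg hC2 (sNumbers_nonneg D n)) hsum
  obtain ⟨Y, W, hYW, rfl, rfl⟩ := exists_add_eq_of_sNumbers hH hX.2.2 hζ hτ hζ0 hτ0 hadd
  refine TwoSidedIdeal.mem_sup.2 ⟨Y, ?_, W, ?_, hYW⟩
  · refine mem_amClosure_of_sum_le hH hB (C := 2 * C) ⟨hζ, hζ0, ?_⟩ fun n => ?_
    · exact squeeze_zero hζ0 (fun n => by linarith [hadd n, hτ0 n]) hX.2.2
    · rw [Finset.mul_sum]
      exact hζB n
  · refine mem_amClosure_of_sum_le hH hD (C := 2 * C) ⟨hτ, hτ0, ?_⟩ fun n => ?_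
    · exact squeeze_zero hτ0 (fun n => by linarith [hadd n, hζ0 n]) hX.2.2
    · rw [Finset.mul_sum]
      exact hτD n

theorem amClosure_sup (hH : ¬ FiniteDimensional ℂ H) (I J : TwoSidedIdeal (H →L[ℂ] H)) :
    amClosure (I ⊔ J) = amClosure I ⊔ amClosure J :=
  le_antisymm (amClosure_sup_le hH I J)
    (sup_le (amClosure_mono le_sup_left) (amClosure_mono le_sup_right))

end Calkin

end OperatorIdeal

theorem theorem2p5 {H : Type*} [NormedAddCommGroup H] [InnerProductSpace ℂ H] [CompleteSpace H]
    [TopologicalSpace.SeparableSpace H] (hH : ¬ FiniteDimensional ℂ H) :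
    (∀ I J : TwoSidedIdeal (H →L[ℂ] H),
      OperatorIdeal.amClosure (I ⊔ J) =
        OperatorIdeal.amClosure I ⊔ OperatorIdeal.amClosure J) ∧
    (∀ I J : TwoSidedIdeal (H →L[ℂ] H),
      OperatorIdeal.IsAmClosed I → OperatorIdeal.IsAmClosed J →
        OperatorIdeal.IsAmClosed (I ⊔ J)) := by
  refine ⟨OperatorIdeal.amClosure_sup hH, fun I J hI hJ => ?_⟩
  unfold OperatorIdeal.IsAmClosed at *
  rw [OperatorIdeal.amClosure_sup hH, hI, hJ]
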